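/- Let $(M,g)$ be a smooth four-dimensional spacetime with metric of signature $(-,+,+,+)$, and let $T=(\rho+p)\,u\otimes u+p\,g$ be a smooth perfect energy tensor on $M$ with $g(u,u)=-1$ and $\rho+p>0$, that is conservative, $\nabla\cdot T=0$. Write $\dot q=u(q)$ and $\theta=\nabla\cdot u$. Assume that $T$ is non-barotropic ($d\rho\wedge dp\neq 0$ everywhere) and isoenergetic ($\dot\rho=0$). A *thermodynamic perfect fluid in local thermal equilibrium* (l.t.e.) is given by an open region $D$ of the $(\rho,p)$-plane on which $\rho+p>0$ and by smooth functions $r=r(\rho,p)>0$ (matter density) and $s=s(\rho,p)$ (specific entropy) on $D$ such that $\Theta\,ds=d\epsilon+p\,dv$ for some nowhere vanishing temperature $\Theta$ on $D$, where $v=1/r$ and $\rho=r(1+\epsilon)$. With the dynamic volume $\tau=(1+\epsilon+pv)\,v=(\rho+p)/r^2$ regarded as a function of $(s,p)$ (which are required to be local coordinates), the fluid satisfies $\mathrm{H}_1$ if $(\tau'_p)_s<0$ and $(\tau''_p)_s>0$ on $D$, it satisfies $\mathrm{H}_2$ if $(\tau'_s)_p>0$ on $D$, and $\bar{\mathrm{H}}_2$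 if $(\tau'_s)_p<0$ on $D$. The tensor $T$ *represents the evolution in l.t.e.* of the fluid $(D,r,s)$ if $(\rho,p)$ takes its values in $D$ and, along the flow, $\dot r+r\theta=0$ and $\dot s=0$. **(1)** $T$ represents the evolution in l.t.e. of a fluid satisfying $\mathrm{H}_1$ and $\mathrm{H}_2$ if and only if $T$ is isobaroenergetic, $\dot\rho=\dot p=0$. Likewise, $T$ represents the evolution in l.t.e. of a fluid satisfying $\mathrm{H}_1$ and $\bar{\mathrm{H}}_2$ if and only if $\dot\rho=\dot p=0$. Suppose that $\dot\rho=\dot p=0$. Then: **(2)** Let $D$ be an open region of the half-plane $\rho+p>0$ that contains all values of $(\rho,p)$ on $M$, and let $r>0$ and $s$ be smooth functions on $D$. Then $T$ represents the evolution in l.t.e. of the fluid $(D,r,s)$, with $\mathrm{H}_1$ satisfied, if and only if $s'_p\ne0$ and $r'_p\neq 0$ on $D$, the two expressions in $$\chi(\rho,p)=-\frac{s'_\rho}{s'_p}=\frac1{r'_p}\Big[\frac r{\rho+p}-r'_\rho\Big]$$ coincide, and the function $\chi$ so defined satisfies, on $D$, $$0<\chi<1,\qquad (\rho+p)(\chi\chi'_p+\chi'_\rho)+2\chi(1-\chi)>0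 .$$ **(3)** Let $(D,r,s)$ be a fluid satisfying $\mathrm{H}_1$ whose evolution in l.t.e. is represented by $T$. For every compact $K\subset D$ there are an open set $V$ with $K\subset V\subset D$ and smooth functions $R>0$ and $S$ of one real variable, with $S'$ nowhere zero, such that $rR(s)$ and $S(s)$ are, on $V$, the matter density and the specific entropy of a fluid in l.t.e. that satisfies $\mathrm{H}_1$ and $\mathrm{H}_2$, and the evolution equations $\dot r+r\theta=0$ and $\dot s=0$ hold for the new quantities wherever $(\rho,p)\in V$. The same holds with $\bar{\mathrm{H}}_2$ in place of $\mathrm{H}_2$. -/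

import Mathlib

open scoped Manifold ContDiff Topology

noncomputable section

/-! ### Spacetimes -/

/-- A smooth Lorentzian metric of signature `(-,+,+,+)` on a four-dimensional manifold. -/
structure LorentzMetric (M : Type*) [TopologicalSpace M]
    [ChartedSpace (EuclideanSpace ℝ (Fin 4)) M] [IsManifold (𝓡 4) ∞ M] where
  /-- the bilinear form on each tangent space -/
  val : ∀ x : M, TangentSpace (𝓡 4) x →L[ℝ] TangentSpace (𝓡 4) x →L[ℝ] ℝ
  symm : ∀ (x : M) (v w : TangentSpace (𝓡 4) x), val x v w = val x w v
  signature : ∀ x : M, ∃ b : Module.Basis (Fin 4) ℝ (TangentSpace (𝓡 4) x),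
    ∀ i j, val x (b i) (b j) = if i = j then (if i = 0 then -1 else 1) else 0
  smooth : ContMDiff (𝓡 4)
    ((𝓡 4).prod 𝓘(ℝ, EuclideanSpace ℝ (Fin 4) →L[ℝ] EuclideanSpace ℝ (Fin 4) →L[ℝ] ℝ)) ∞
    (fun x => Bundle.TotalSpace.mk'
      (EuclideanSpace ℝ (Fin 4) →L[ℝ] EuclideanSpace ℝ (Fin 4) →L[ℝ] ℝ) x (val x))

section Spacetime

variable {M : Type*} [TopologicalSpace M]
  [ChartedSpace (EuclideanSpace ℝ (Fin 4)) M] [IsManifold (𝓡 4) ∞ M]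

/-- A vector field on `M`, seen as a map into the tangent bundle. -/
def vectorFieldMap (X : ∀ x : M, TangentSpace (𝓡 4) x) (x : M) : TangentBundle (𝓡 4) M :=
  ⟨x, X x⟩

/-- The derivative `v(q)` of a scalar field `q` at `x` in the direction `v`. -/
def scalarDeriv (q : M → ℝ) (x : M) (v : TangentSpace (𝓡 4) x) : ℝ :=
  mvfderiv (𝓡 4) q x v

/-- `∇` is the Levi-Civita connection of `g`: torsion free, and `∇ g = 0`.
Here `∇ Y x v` is the covariant derivative of `Y` at `x` in the direction `v`. -/
structure IsLeviCivita (g : LorentzMetric M)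
    (nabla : CovariantDerivative (𝓡 4) (EuclideanSpace ℝ (Fin 4))
      (TangentSpace (𝓡 4) : M → Type _)) : Prop where
  torsion_free : ∀ (X Y : ∀ x : M, TangentSpace (𝓡 4) x) (x : M),
    MDifferentiableAt (𝓡 4) (𝓡 4).tangent (vectorFieldMap X) x →
    MDifferentiableAt (𝓡 4) (𝓡 4).tangent (vectorFieldMap Y) x →
    nabla Y x (X x) - nabla X x (Y x) = VectorField.mlieBracket (𝓡 4) X Y x
  metric : ∀ (Y Z : ∀ x : M, TangentSpace (𝓡 4) x) (x : M) (v : TangentSpace (𝓡 4) x),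
    MDifferentiableAt (𝓡 4) (𝓡 4).tangent (vectorFieldMap Y) x →
    MDifferentiableAt (𝓡 4) (𝓡 4).tangent (vectorFieldMap Z) x →
    scalarDeriv (fun y => g.val y (Y y) (Z y)) x v
      = g.val x (nabla Y x v) (Z x) + g.val x (Y x) (nabla Z x v)

/-- The divergence `∇_α X^α` of a vector field: the trace of `v ↦ ∇_v X`. -/
def divVector (nabla : CovariantDerivative (𝓡 4) (EuclideanSpace ℝ (Fin 4))
      (TangentSpace (𝓡 4) : M → Type _)) (X : ∀ x : M, TangentSpace (𝓡 4) x) (x : M) : ℝ :=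
  LinearMap.trace ℝ (TangentSpace (𝓡 4) x) (nabla X x).toLinearMap

/-- The divergence of a mixed 2-tensor `A`, contracted with a vector field `Z`, that is
`(∇_α A^α_β) Z^β`: the trace of `v ↦ (∇_v A)(Z) = ∇_v (A Z) - A (∇_v Z)`. -/
def divTensor (nabla : CovariantDerivative (𝓡 4) (EuclideanSpace ℝ (Fin 4))
      (TangentSpace (𝓡 4) : M → Type _))
    (A : ∀ x : M, TangentSpace (𝓡 4) x →L[ℝ] TangentSpace (𝓡 4) x)
    (Z : ∀ x : M, TangentSpace (𝓡 4) x) (x : M) : ℝ :=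
  LinearMap.trace ℝ (TangentSpace (𝓡 4) x)
    (nabla (fun y => A y (Z y)) x - (A x).comp (nabla Z x)).toLinearMap

/-! ### Perfect energy tensors -/

/-- The hydrodynamic quantities `u, ρ, p` of a perfect energy tensor: a unit time-like vector
field and two scalar fields, with `ρ + p > 0`. -/
structure PerfectEnergyTensor (g : LorentzMetric M) where
  /-- unit velocity -/
  u : ∀ x : M, TangentSpace (𝓡 4) x
  /-- energy density -/
  rho : M → ℝ
  /-- pressure -/
  p : M → ℝ
  smooth_u : ContMDiff (𝓡 4) (𝓡 4).tangent ∞ (vectorFieldMap u)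
  smooth_rho : ContMDiff (𝓡 4) 𝓘(ℝ, ℝ) ∞ rho
  smooth_p : ContMDiff (𝓡 4) 𝓘(ℝ, ℝ) ∞ p
  unit_u : ∀ x, g.val x (u x) (u x) = -1
  enthalpy_pos : ∀ x, 0 < rho x + p x

namespace PerfectEnergyTensor

variable {g : LorentzMetric M} (T : PerfectEnergyTensor g)

/-- The tensor `T = (ρ + p) u ⊗ u + p g`. -/
def tensor (x : M) (v w : TangentSpace (𝓡 4) x) : ℝ :=
  (T.rho x + T.p x) * (g.val x (T.u x) v * g.val x (T.u x) w) + T.p x * g.val x v w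

/-- The mixed form `T^α_β = (ρ + p) u^α u_β + p δ^α_β`. -/
def mixed (x : M) : TangentSpace (𝓡 4) x →L[ℝ] TangentSpace (𝓡 4) x :=
  (T.rho x + T.p x) • (g.val x (T.u x)).smulRight (T.u x)
    + T.p x • ContinuousLinearMap.id ℝ (TangentSpace (𝓡 4) x)

/-- `mixed` is `tensor` with one index raised. -/
theorem val_mixed (x : M) (v w : TangentSpace (𝓡 4) x) :
    g.val x (T.mixed x v) w = T.tensor x v w := by
  simp [mixed, tensor]

/-- `∇ · T = 0`. -/
def IsConservative (nabla : CovariantDerivative (𝓡 4) (EuclideanSpace ℝ (Fin 4))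
      (TangentSpace (𝓡 4) : M → Type _)) : Prop :=
  ∀ Z : ∀ x : M, TangentSpace (𝓡 4) x,
    ContMDiff (𝓡 4) (𝓡 4).tangent ∞ (vectorFieldMap Z) →
      ∀ x, divTensor nabla T.mixed Z x = 0

/-- The derivative `q̇ = u(q)` of a scalar field along the flow. -/
def dot (q : M → ℝ) (x : M) : ℝ := scalarDeriv q x (T.u x)

/-- `dρ ∧ dp ≠ 0` at every point. -/
def IsNonBarotropic : Prop :=
  ∀ x, LinearIndependent ℝ
    ![mvfderiv (𝓡 4) T.rho x, mvfderiv (𝓡 4) T.p x]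

/-- `ρ̇ = 0`. -/
def IsIsoenergetic : Prop := ∀ x, T.dot T.rho x = 0

/-- `ρ̇ = ṗ = 0`. -/
def IsIsobaroenergetic : Prop := ∀ x, T.dot T.rho x = 0 ∧ T.dot T.p x = 0

/-- The point `(ρ, p)` of the thermodynamic plane. -/
def state (x : M) : ℝ × ℝ := (T.rho x, T.p x)

end PerfectEnergyTensor

end Spacetime

/-! ### Thermodynamics

Functions of state are functions on an open region of the plane of the pairs `(ρ, p)`. -/

/-- `(z'_ρ)_p` -/
def dRho (z : ℝ × ℝ → ℝ) (y : ℝ × ℝ) : ℝ := fderiv ℝ z y (1, 0)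

/-- `(z'_p)_ρ` -/
def dP (z : ℝ × ℝ → ℝ) (y : ℝ × ℝ) : ℝ := fderiv ℝ z y (0, 1)

/-- specific volume `v = 1 / r` -/
def specificVolume (r : ℝ × ℝ → ℝ) (y : ℝ × ℝ) : ℝ := 1 / r y

/-- specific internal energy `ε`, defined by `ρ = r (1 + ε)` -/
def internalEnergy (r : ℝ × ℝ → ℝ) (y : ℝ × ℝ) : ℝ := y.1 / r y - 1

/-- enthalpy index `f = 1 + i`, where `i = ε + p v` -/
def enthalpyIndex (r : ℝ × ℝ → ℝ) (y : ℝ × ℝ) : ℝ :=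
  1 + (internalEnergy r y + y.2 * specificVolume r y)

/-- dynamic volume `τ = f v` -/
def dynamicVolume (r : ℝ × ℝ → ℝ) (y : ℝ × ℝ) : ℝ := enthalpyIndex r y * specificVolume r y

/-- An open region of the `(ρ, p)`-plane with `ρ + p > 0`, carrying a smooth positive matter
density `r` and a smooth specific entropy `s`. -/
structure IsStateData (D : Set (ℝ × ℝ)) (r s : ℝ × ℝ → ℝ) : Prop where
  isOpen : IsOpen D
  enthalpy_pos : ∀ y ∈ D, 0 < y.1 + y.2
  smooth_r : ContDiffOn ℝ ∞ r D
  smooth_s : ContDiffOn ℝ ∞ s D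
  r_pos : ∀ y ∈ D, 0 < r y

/-- The quantities `r, s` on `D` are those of a thermodynamic perfect fluid in local thermal
equilibrium: there is a (nowhere vanishing) temperature `Θ` with `Θ ds = dε + p dv`. -/
structure IsLTEFluid (D : Set (ℝ × ℝ)) (r s : ℝ × ℝ → ℝ) : Prop extends IsStateData D r s where
  energy_balance : ∃ Theta : ℝ × ℝ → ℝ, ∀ y ∈ D, Theta y ≠ 0 ∧
    Theta y • fderiv ℝ s y
      = fderiv ℝ (internalEnergy r) y + y.2 • fderiv ℝ (specificVolume r) y

/-- `(s, p)` are local coordinates of the thermodynamic plane at `y`, and `Z` is the smooth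
expression of the function of state `z` in these coordinates: `z = Z(s, p)` near `y`. -/
structure IsEntropyPressureExpression (s z Z : ℝ × ℝ → ℝ) (y : ℝ × ℝ) : Prop where
  coordinates : Function.Bijective (fderiv ℝ (fun y' : ℝ × ℝ => (s y', y'.2)) y)
  smooth : ContDiffAt ℝ ∞ Z (s y, y.2)
  eq : ∀ᶠ y' in 𝓝 y, z y' = Z (s y', y'.2)

/-- `H₁` on `D`: `(τ'_p)_s < 0` and `(τ''_p)_s > 0`. -/
def SatisfiesH1 (D : Set (ℝ × ℝ)) (r s : ℝ × ℝ → ℝ) : Prop :=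
  ∀ y ∈ D, ∃ tau : ℝ × ℝ → ℝ, IsEntropyPressureExpression s (dynamicVolume r) tau y ∧
    deriv (fun q => tau (s y, q)) y.2 < 0 ∧ 0 < iteratedDeriv 2 (fun q => tau (s y, q)) y.2

/-- `H₂` on `D`: `(τ'_s)_p > 0`. -/
def SatisfiesH2 (D : Set (ℝ × ℝ)) (r s : ℝ × ℝ → ℝ) : Prop :=
  ∀ y ∈ D, ∃ tau : ℝ × ℝ → ℝ, IsEntropyPressureExpression s (dynamicVolume r) tau y ∧
    0 < deriv (fun a => tau (a, y.2)) (s y)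

/-- `H̄₂` on `D`: `(τ'_s)_p < 0`. -/
def SatisfiesH2bar (D : Set (ℝ × ℝ)) (r s : ℝ × ℝ → ℝ) : Prop :=
  ∀ y ∈ D, ∃ tau : ℝ × ℝ → ℝ, IsEntropyPressureExpression s (dynamicVolume r) tau y ∧
    deriv (fun a => tau (a, y.2)) (s y) < 0

/-- `r` and `s` define the square `χ(ρ, p)` of the speed of sound on `D`:
`χ = - s'_ρ / s'_p = (1 / r'_p) (r / (ρ + p) - r'_ρ)`. -/
def IsSquareSoundSpeed (D : Set (ℝ × ℝ)) (r s chi : ℝ × ℝ → ℝ) : Prop :=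
  ∀ y ∈ D, dP s y ≠ 0 ∧ dP r y ≠ 0 ∧ chi y = -(dRho s y / dP s y) ∧
    chi y = 1 / dP r y * (r y / (y.1 + y.2) - dRho r y)

/-- The inequalities for `χ(ρ, p)` that express `H₁`:
`0 < χ < 1` and `(ρ + p) (χ χ'_p + χ'_ρ) + 2 χ (1 - χ) > 0`. -/
def SatisfiesH1Chi (D : Set (ℝ × ℝ)) (chi : ℝ × ℝ → ℝ) : Prop :=
  ∀ y ∈ D, 0 < chi y ∧ chi y < 1 ∧
    0 < (y.1 + y.2) * (chi y * dP chi y + dRho chi y) + 2 * chi y * (1 - chi y)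

/-! ### Evolution of a fluid -/

section Evolution

variable {M : Type*} [TopologicalSpace M]
  [ChartedSpace (EuclideanSpace ℝ (Fin 4)) M] [IsManifold (𝓡 4) ∞ M] {g : LorentzMetric M}

/-- Wherever the state of the flow lies in `D`, the matter density is conserved and the evolution
is adiabatic: `ṙ + r θ = 0` and `ṡ = 0`, where `θ = ∇ · u`. -/
def PerfectEnergyTensor.EvolutionEquations (T : PerfectEnergyTensor g)
    (nabla : CovariantDerivative (𝓡 4) (EuclideanSpace ℝ (Fin 4))
      (TangentSpace (𝓡 4) : M → Type _)) (D : Set (ℝ × ℝ)) (r s : ℝ × ℝ → ℝ) : Prop :=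
  ∀ x, T.state x ∈ D →
    T.dot (fun x' => r (T.state x')) x + r (T.state x) * divVector nabla T.u x = 0 ∧
      T.dot (fun x' => s (T.state x')) x = 0

/-- `T` represents an evolution in local thermal equilibrium of the thermodynamic perfect fluid
with quantities `r, s` on the region `D` of the `(ρ, p)`-plane. -/
structure PerfectEnergyTensor.Represents (T : PerfectEnergyTensor g)
    (nabla : CovariantDerivative (𝓡 4) (EuclideanSpace ℝ (Fin 4))
      (TangentSpace (𝓡 4) : M → Type _)) (D : Set (ℝ × ℝ)) (r s : ℝ × ℝ → ℝ) : Prop where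
  fluid : IsLTEFluid D r s
  state_mem : ∀ x, T.state x ∈ D
  evolution : T.EvolutionEquations nabla D r s

end Evolution

end

/-! Contracting `∇ · T = 0` with `u` gives `ρ̇ + (ρ + p) θ = 0`, so `ρ̇ = 0` forces `θ = 0`
(`divVector_eq_zero`). If moreover `ṗ = 0`, every function of state is constant along the flow, and
the evolution equations hold for any state data whatsoever. Conversely `ṡ = s'_p ṗ`, and `H₁`
forbids `s'_p = 0`: the energy balance would give `r'_p = 0`, hence `(τ'_p)_s = 1 / r² > 0`. So `ṗ =
0`. Only existence is then missing in (1), and a fluid with constant `χ = 1/3` provides it, the sign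
of its entropy deciding between `H₂` and `H̄₂`.

For (2), eliminating `Θ` from the two components of the energy balance gives the equality of the two
expressions of `χ`. With `(∂_p)_s = ∂_p - (s'_p / s'_ρ) ∂_ρ = ∂_p + (1/χ) ∂_ρ`, the two derivatives
of `τ` in `H₁` become explicit in `χ` and `r` (`satisfiesH1_iff_satisfiesH1Chi`).

For (3), replacing `(r, s)` by `(r e^{-λ s}, c s)` preserves `χ`, hence `H₁`, and turns `(τ'_s)_p`
into `(τ'_s + 2 λ τ) e^{2 λ s} / c`. As `τ > 0`, a large `λ` makes the bracket positive on a compact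
set, and the sign of `c` does the rest (`exists_rescaled_fluid`). -/

/-! ### The coordinates `(s, p)` on the `(ρ, p)`-plane. -/

theorem fderiv_prod_apply_eq (z : ℝ × ℝ → ℝ) (y v : ℝ × ℝ) :
    fderiv ℝ z y v = v.1 * dRho z y + v.2 * dP z y := by
  have hv : v = v.1 • ((1, 0) : ℝ × ℝ) + v.2 • ((0, 1) : ℝ × ℝ) := by ext <;> simp
  conv_lhs => rw [hv]
  simp only [map_add, map_smul, smul_eq_mul, dRho, dP]

/-- The derivative of `z` with respect to the pressure at constant `s`, expressed through the
partial derivatives in the `(ρ, p)`-plane. -/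
noncomputable def isentropicDeriv (s z : ℝ × ℝ → ℝ) (y : ℝ × ℝ) : ℝ :=
  dP z y - dRho z y * (dP s y / dRho s y)

theorem Filter.EventuallyEq.dRho_eq {z w : ℝ × ℝ → ℝ} {y : ℝ × ℝ} (h : z =ᶠ[𝓝 y] w) :
    dRho z y = dRho w y := by
  simp only [dRho, h.fderiv_eq]

theorem Filter.EventuallyEq.dP_eq {z w : ℝ × ℝ → ℝ} {y : ℝ × ℝ} (h : z =ᶠ[𝓝 y] w) :
    dP z y = dP w y := by
  simp only [dP, h.fderiv_eq]

theorem Filter.EventuallyEq.isentropicDeriv_eq {s z w : ℝ × ℝ → ℝ} {y : ℝ × ℝ}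
    (h : z =ᶠ[𝓝 y] w) : isentropicDeriv s z y = isentropicDeriv s w y := by
  simp only [isentropicDeriv, h.dRho_eq, h.dP_eq]

theorem hasFDerivAt_entropyPressure {s : ℝ × ℝ → ℝ} {y : ℝ × ℝ} (hs : DifferentiableAt ℝ s y) :
    HasFDerivAt (fun y' : ℝ × ℝ => (s y', y'.2))
      ((fderiv ℝ s y).prod (ContinuousLinearMap.snd ℝ ℝ ℝ)) y :=
  hs.hasFDerivAt.prodMk hasFDerivAt_snd

/-- The Jacobian of `(ρ, p) ↦ (s, p)` is triangular with determinant `s'_ρ`. -/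
theorem bijective_fderiv_entropyPressure_iff {s : ℝ × ℝ → ℝ} {y : ℝ × ℝ}
    (hs : DifferentiableAt ℝ s y) :
    Function.Bijective (fderiv ℝ (fun y' : ℝ × ℝ => (s y', y'.2)) y) ↔ dRho s y ≠ 0 := by
  rw [(hasFDerivAt_entropyPressure hs).fderiv]
  constructor
  · intro h h0
    have h1 : ((1, 0) : ℝ × ℝ) = 0 := by
      apply h.1
      ext
      · simpa [dRho] using h0
      · simp
    simpa using congrArg Prod.fst h1
  · intro h
    refine ⟨fun v w hvw => ?_, fun w => ⟨((w.1 - w.2 * dP s y) / dRho s y, w.2), ?_⟩⟩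
    · simp only [ContinuousLinearMap.prod_apply, fderiv_prod_apply_eq,
        ContinuousLinearMap.coe_snd', Prod.mk.injEq] at hvw
      obtain ⟨h1, h2⟩ := hvw
      rw [h2] at h1
      exact Prod.ext (mul_right_cancel₀ h (add_right_cancel h1)) h2
    · ext
      · simp only [ContinuousLinearMap.prod_apply, fderiv_prod_apply_eq]
        field_simp
        ring
      · simp

/-! ### Derivatives in `(s, p)` computed in `(ρ, p)`. -/

section Expression

variable {s z Z : ℝ × ℝ → ℝ} {y : ℝ × ℝ}

theorem fderiv_eq_of_eventually_eq_comp (hs : DifferentiableAt ℝ s y)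
    (hZ : DifferentiableAt ℝ Z (s y, y.2)) (h : ∀ᶠ y' in 𝓝 y, z y' = Z (s y', y'.2)) :
    dRho z y = dRho Z (s y, y.2) * dRho s y ∧
      dP z y = dRho Z (s y, y.2) * dP s y + dP Z (s y, y.2) := by
  have h1 : HasFDerivAt z ((fderiv ℝ Z (s y, y.2)).comp
      ((fderiv ℝ s y).prod (ContinuousLinearMap.snd ℝ ℝ ℝ))) y := by
    refine HasFDerivAt.congr_of_eventuallyEq ?_ h
    exact HasFDerivAt.comp (f := fun y' : ℝ × ℝ => (s y', y'.2)) y hZ.hasFDerivAt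
      (hasFDerivAt_entropyPressure hs)
  have h2 : ∀ v : ℝ × ℝ, fderiv ℝ z y v
      = fderiv ℝ s y v * dRho Z (s y, y.2) + v.2 * dP Z (s y, y.2) := fun v => by
    rw [h1.fderiv, ContinuousLinearMap.comp_apply, fderiv_prod_apply_eq Z]
    rfl
  constructor
  · refine (h2 (1, 0)).trans ?_
    simp only [fderiv_prod_apply_eq s]
    ring
  · refine (h2 (0, 1)).trans ?_
    simp only [fderiv_prod_apply_eq s]
    ring

theorem dP_eq_isentropicDeriv (hs : DifferentiableAt ℝ s y) (hs0 : dRho s y ≠ 0)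
    (hZ : DifferentiableAt ℝ Z (s y, y.2)) (h : ∀ᶠ y' in 𝓝 y, z y' = Z (s y', y'.2)) :
    dP Z (s y, y.2) = isentropicDeriv s z y := by
  obtain ⟨h1, h2⟩ := fderiv_eq_of_eventually_eq_comp hs hZ h
  rw [isentropicDeriv, h1, h2]
  field_simp
  ring

theorem deriv_snd_eq_dP {a q : ℝ} (hZ : DifferentiableAt ℝ Z (a, q)) :
    deriv (fun q' => Z (a, q')) q = dP Z (a, q) := by
  have h : HasDerivAt (fun q' : ℝ => ((a, q') : ℝ × ℝ)) (0, 1) q :=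
    (hasDerivAt_const q a).prodMk (hasDerivAt_id q)
  exact (HasFDerivAt.comp_hasDerivAt (f := fun q' : ℝ => ((a, q') : ℝ × ℝ)) q hZ.hasFDerivAt h).deriv

theorem deriv_fst_eq_dRho {a q : ℝ} (hZ : DifferentiableAt ℝ Z (a, q)) :
    deriv (fun a' => Z (a', q)) a = dRho Z (a, q) := by
  have h : HasDerivAt (fun a' : ℝ => ((a', q) : ℝ × ℝ)) (1, 0) a :=
    (hasDerivAt_id a).prodMk (hasDerivAt_const a q)
  exact (HasFDerivAt.comp_hasDerivAt (f := fun a' : ℝ => ((a', q) : ℝ × ℝ)) a hZ.hasFDerivAt h).deriv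

namespace IsEntropyPressureExpression

variable (h : IsEntropyPressureExpression s z Z y)
include h

theorem differentiableAt : DifferentiableAt ℝ Z (s y, y.2) :=
  h.smooth.differentiableAt (by simp)

theorem dRho_ne_zero (hs : DifferentiableAt ℝ s y) : dRho s y ≠ 0 :=
  (bijective_fderiv_entropyPressure_iff hs).1 h.coordinates

theorem deriv_pressure (hs : DifferentiableAt ℝ s y) :
    deriv (fun q => Z (s y, q)) y.2 = isentropicDeriv s z y := by
  rw [deriv_snd_eq_dP h.differentiableAt]
  exact dP_eq_isentropicDeriv hs (h.dRho_ne_zero hs) h.differentiableAt h.eq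

theorem deriv_entropy (hs : DifferentiableAt ℝ s y) :
    deriv (fun a => Z (a, y.2)) (s y) = dRho z y / dRho s y := by
  rw [deriv_fst_eq_dRho h.differentiableAt,
    (fderiv_eq_of_eventually_eq_comp hs h.differentiableAt h.eq).1,
    mul_div_cancel_right₀ _ (h.dRho_ne_zero hs)]

theorem eventually_differentiableAt : ∀ᶠ t in 𝓝 (s y, y.2), DifferentiableAt ℝ Z t := by
  have h1 : ContDiffAt ℝ 1 Z (s y, y.2) := h.smooth.of_le (by exact_mod_cast le_top)
  filter_upwards [h1.eventually (by simp)] with t ht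
  exact ht.differentiableAt (by simp)

/-- Differentiating with respect to the pressure at constant entropy. -/
theorem isentropic (hs : ContDiffAt ℝ 1 s y) :
    IsEntropyPressureExpression s (isentropicDeriv s z) (dP Z) y where
  coordinates := h.coordinates
  smooth := by
    have h1 : ContDiffAt ℝ ∞ (fderiv ℝ Z) (s y, y.2) :=
      h.smooth.fderiv_right (by simp)
    exact h1.clm_apply contDiffAt_const
  eq := by
    have hsd := hs.differentiableAt (by simp)
    have hc : Filter.Tendsto (fun y' : ℝ × ℝ => (s y', y'.2)) (𝓝 y) (𝓝 (s y, y.2)) :=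
      hsd.continuousAt.prodMk continuousAt_snd
    -- The identity is needed on a neighbourhood, so `s'_ρ ≠ 0` has to be propagated from `y` to
    -- nearby points.
    have hs0 : ∀ᶠ y' in 𝓝 y, dRho s y' ≠ 0 := by
      have : ContinuousAt (dRho s) y :=
        ((hs.fderiv_right (m := 0) (by simp)).continuousAt).clm_apply continuousAt_const
      exact this.eventually_ne (h.dRho_ne_zero hsd)
    filter_upwards [hc.eventually h.eventually_differentiableAt, h.eq.eventually_nhds, hs0,
      hs.eventually (by simp)] with y' h1 h2 h3 h4
    exact (dP_eq_isentropicDeriv (h4.differentiableAt (by simp)) h3 h1 h2).symm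

/-- By `isentropic`, `dP Z` expresses the first isentropic derivative in `(s, p)`, so the
first-order formula can be applied a second time. -/
theorem iteratedDeriv_two_pressure (hs : ContDiffAt ℝ 1 s y) :
    iteratedDeriv 2 (fun q => Z (s y, q)) y.2 = isentropicDeriv s (isentropicDeriv s z) y := by
  have hc : Filter.Tendsto (fun q : ℝ => (s y, q)) (𝓝 y.2) (𝓝 (s y, y.2)) :=
    (continuous_const.prodMk continuous_id).continuousAt
  have h1 : deriv (fun q => Z (s y, q)) =ᶠ[𝓝 y.2] fun q => dP Z (s y, q) := by
    filter_upwards [hc.eventually h.eventually_differentiableAt] with q hq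
    exact deriv_snd_eq_dP hq
  rw [iteratedDeriv_succ, iteratedDeriv_one, h1.deriv_eq]
  exact (h.isentropic hs).deriv_pressure (hs.differentiableAt (by simp))

end IsEntropyPressureExpression

/-- Inverse function theorem: `Z` is `z` composed with a smooth local inverse of `(ρ, p) ↦ (s, p)`.
-/
theorem exists_isEntropyPressureExpression (hs : ContDiffAt ℝ ∞ s y) (hz : ContDiffAt ℝ ∞ z y)
    (hs0 : dRho s y ≠ 0) : ∃ Z, IsEntropyPressureExpression s z Z y := by
  have hsd := hs.differentiableAt (by simp)
  have hb := (bijective_fderiv_entropyPressure_iff hsd).2 hs0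
  have hΦ : ContDiffAt ℝ ∞ (fun y' : ℝ × ℝ => (s y', y'.2)) y := hs.prodMk contDiffAt_snd
  have hd : HasFDerivAt (fun y' : ℝ × ℝ => (s y', y'.2))
      (ContinuousLinearEquiv.ofBijective _ (LinearMap.ker_eq_bot.2 hb.1)
        (LinearMap.range_eq_top.2 hb.2) : ℝ × ℝ →L[ℝ] ℝ × ℝ) y := by
    rw [ContinuousLinearEquiv.coe_ofBijective]
    exact (hΦ.differentiableAt (by simp)).hasFDerivAt
  have hn : (∞ : WithTop ℕ∞) ≠ 0 := by simp
  refine ⟨z ∘ hΦ.localInverse hd hn, hb, ?_, ?_⟩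
  · refine ContDiffAt.comp _ ?_ (hΦ.to_localInverse hd hn)
    rw [hΦ.localInverse_apply_image hd hn]
    exact hz
  · filter_upwards [(hΦ.hasStrictFDerivAt' hd hn).eventually_left_inverse] with y' hy'
    exact congrArg z hy'.symm

end Expression

/-! ### Calculus of partial derivatives. -/

section PartialDerivatives

variable {z w : ℝ × ℝ → ℝ} {y : ℝ × ℝ} {a b : ℝ}

theorem hasDerivAt_dRho (hz : DifferentiableAt ℝ z y) :
    HasDerivAt (fun t => z (t, y.2)) (dRho z y) y.1 :=
  HasFDerivAt.comp_hasDerivAt (f := fun t : ℝ => ((t, y.2) : ℝ × ℝ)) y.1 hz.hasFDerivAt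
    ((hasDerivAt_id y.1).prodMk (hasDerivAt_const y.1 y.2))

theorem hasDerivAt_dP (hz : DifferentiableAt ℝ z y) :
    HasDerivAt (fun t => z (y.1, t)) (dP z y) y.2 :=
  HasFDerivAt.comp_hasDerivAt (f := fun t : ℝ => ((y.1, t) : ℝ × ℝ)) y.2 hz.hasFDerivAt
    ((hasDerivAt_const y.2 y.1).prodMk (hasDerivAt_id y.2))

theorem dRho_eq_of_hasDerivAt (hz : DifferentiableAt ℝ z y)
    (h : HasDerivAt (fun t => z (t, y.2)) a y.1) : dRho z y = a :=
  (hasDerivAt_dRho hz).unique h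

theorem dP_eq_of_hasDerivAt (hz : DifferentiableAt ℝ z y)
    (h : HasDerivAt (fun t => z (y.1, t)) a y.2) : dP z y = a :=
  (hasDerivAt_dP hz).unique h

theorem ContDiffOn.dRho {D : Set (ℝ × ℝ)} (hD : IsOpen D) (hz : ContDiffOn ℝ ∞ z D) :
    ContDiffOn ℝ ∞ (dRho z) D :=
  (hz.fderiv_of_isOpen hD (by simp)).clm_apply contDiffOn_const

theorem ContDiffOn.dP {D : Set (ℝ × ℝ)} (hD : IsOpen D) (hz : ContDiffOn ℝ ∞ z D) :
    ContDiffOn ℝ ∞ (dP z) D :=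
  (hz.fderiv_of_isOpen hD (by simp)).clm_apply contDiffOn_const

theorem differentiableAt_div_prod (hz : DifferentiableAt ℝ z y) (hw : DifferentiableAt ℝ w y)
    (h0 : w y ≠ 0) : DifferentiableAt ℝ (fun y => z y / w y) y := by
  simpa only [div_eq_mul_inv] using hz.fun_mul (hw.fun_inv h0)

theorem dRho_div_sq (hz : DifferentiableAt ℝ z y) (hw : DifferentiableAt ℝ w y) (h0 : w y ≠ 0) :
    dRho (fun y => z y / w y ^ 2) y = dRho z y / w y ^ 2 - 2 * z y * dRho w y / w y ^ 3 := by
  refine dRho_eq_of_hasDerivAt (differentiableAt_div_prod hz (hw.fun_pow 2) (pow_ne_zero 2 h0)) ?_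
  refine ((hasDerivAt_dRho hz).fun_div ((hasDerivAt_dRho hw).fun_pow 2)
    (pow_ne_zero 2 h0)).congr_deriv ?_
  field_simp
  norm_num
  ring

theorem dP_div_sq (hz : DifferentiableAt ℝ z y) (hw : DifferentiableAt ℝ w y) (h0 : w y ≠ 0) :
    dP (fun y => z y / w y ^ 2) y = dP z y / w y ^ 2 - 2 * z y * dP w y / w y ^ 3 := by
  refine dP_eq_of_hasDerivAt (differentiableAt_div_prod hz (hw.fun_pow 2) (pow_ne_zero 2 h0)) ?_
  refine ((hasDerivAt_dP hz).fun_div ((hasDerivAt_dP hw).fun_pow 2)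
    (pow_ne_zero 2 h0)).congr_deriv ?_
  field_simp
  norm_num
  ring

theorem dRho_one_sub_inv (hz : DifferentiableAt ℝ z y) (h0 : z y ≠ 0) :
    dRho (fun y => 1 - (z y)⁻¹) y = dRho z y / z y ^ 2 := by
  refine dRho_eq_of_hasDerivAt ((hz.fun_inv h0).const_sub 1) ?_
  refine (((hasDerivAt_dRho hz).fun_inv h0).const_sub 1).congr_deriv ?_
  ring

theorem dP_one_sub_inv (hz : DifferentiableAt ℝ z y) (h0 : z y ≠ 0) :
    dP (fun y => 1 - (z y)⁻¹) y = dP z y / z y ^ 2 := by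
  refine dP_eq_of_hasDerivAt ((hz.fun_inv h0).const_sub 1) ?_
  refine (((hasDerivAt_dP hz).fun_inv h0).const_sub 1).congr_deriv ?_
  ring

theorem dRho_fst_add_snd : dRho (fun y => y.1 + y.2) y = 1 :=
  dRho_eq_of_hasDerivAt (differentiableAt_fst.fun_add differentiableAt_snd)
    ((hasDerivAt_id y.1).add_const y.2)

theorem dP_fst_add_snd : dP (fun y => y.1 + y.2) y = 1 :=
  dP_eq_of_hasDerivAt (differentiableAt_fst.fun_add differentiableAt_snd)
    ((hasDerivAt_id y.2).const_add y.1)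

end PartialDerivatives

/-! ### Energy balance, speed of sound and `H₁`. -/

section Thermodynamics

theorem dynamicVolume_eq (r : ℝ × ℝ → ℝ) :
    dynamicVolume r = fun y => (y.1 + y.2) / r y ^ 2 := by
  funext y
  simp only [dynamicVolume, enthalpyIndex, internalEnergy, specificVolume]
  ring

theorem dRho_dynamicVolume {r : ℝ × ℝ → ℝ} {y : ℝ × ℝ} (hr : DifferentiableAt ℝ r y)
    (h0 : r y ≠ 0) :
    dRho (dynamicVolume r) y = 1 / r y ^ 2 - 2 * (y.1 + y.2) * dRho r y / r y ^ 3 := by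
  rw [dynamicVolume_eq, dRho_div_sq (differentiableAt_fst.fun_add differentiableAt_snd) hr h0,
    dRho_fst_add_snd]

theorem dP_dynamicVolume {r : ℝ × ℝ → ℝ} {y : ℝ × ℝ} (hr : DifferentiableAt ℝ r y)
    (h0 : r y ≠ 0) :
    dP (dynamicVolume r) y = 1 / r y ^ 2 - 2 * (y.1 + y.2) * dP r y / r y ^ 3 := by
  rw [dynamicVolume_eq, dP_div_sq (differentiableAt_fst.fun_add differentiableAt_snd) hr h0,
    dP_fst_add_snd]

theorem energy_balance_iff {r s : ℝ × ℝ → ℝ} {y : ℝ × ℝ} (hr : DifferentiableAt ℝ r y)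
    (h0 : r y ≠ 0) (Theta : ℝ) :
    Theta • fderiv ℝ s y
        = fderiv ℝ (internalEnergy r) y + y.2 • fderiv ℝ (specificVolume r) y ↔
      Theta * dRho s y = 1 / r y - (y.1 + y.2) * dRho r y / r y ^ 2 ∧
        Theta * dP s y = -((y.1 + y.2) * dP r y / r y ^ 2) := by
  have hvd : DifferentiableAt ℝ (specificVolume r) y := differentiableAt_div_prod (differentiableAt_const 1) hr h0
  have hed : DifferentiableAt ℝ (internalEnergy r) y :=
    (differentiableAt_div_prod differentiableAt_fst hr h0).sub_const 1
  have hv1 : dRho (specificVolume r) y = -(dRho r y / r y ^ 2) :=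
    dRho_eq_of_hasDerivAt hvd (((hasDerivAt_const y.1 (1 : ℝ)).fun_div (hasDerivAt_dRho hr)
      h0).congr_deriv (by simp; ring))
  have hv2 : dP (specificVolume r) y = -(dP r y / r y ^ 2) :=
    dP_eq_of_hasDerivAt hvd (((hasDerivAt_const y.2 (1 : ℝ)).fun_div (hasDerivAt_dP hr)
      h0).congr_deriv (by simp; ring))
  have he1 : dRho (internalEnergy r) y = 1 / r y - y.1 * dRho r y / r y ^ 2 :=
    dRho_eq_of_hasDerivAt hed ((((hasDerivAt_id y.1).fun_div (hasDerivAt_dRho hr)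
      h0).sub_const 1).congr_deriv (by simp; field_simp))
  have he2 : dP (internalEnergy r) y = -(y.1 * dP r y / r y ^ 2) :=
    dP_eq_of_hasDerivAt hed ((((hasDerivAt_const y.2 y.1).fun_div (hasDerivAt_dP hr)
      h0).sub_const 1).congr_deriv (by simp; ring))
  constructor
  · intro h
    have h1 := congrArg (fun L => L (1, 0)) h
    have h2 := congrArg (fun L => L (0, 1)) h
    simp only [add_apply, smul_apply, smul_eq_mul,
      fderiv_prod_apply_eq, hv1, hv2, he1, he2] at h1 h2
    exact ⟨by linear_combination h1, by linear_combination h2⟩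
  · rintro ⟨h1, h2⟩
    refine ContinuousLinearMap.ext fun v => ?_
    simp only [add_apply, smul_apply, smul_eq_mul,
      fderiv_prod_apply_eq, hv1, hv2, he1, he2]
    linear_combination v.1 * h1 + v.2 * h2

namespace IsStateData

variable {D : Set (ℝ × ℝ)} {r s chi : ℝ × ℝ → ℝ} {y : ℝ × ℝ} (h : IsStateData D r s)
include h

theorem contDiffAt_r (hy : y ∈ D) : ContDiffAt ℝ ∞ r y :=
  h.smooth_r.contDiffAt (h.isOpen.mem_nhds hy)

theorem contDiffAt_s (hy : y ∈ D) : ContDiffAt ℝ ∞ s y :=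
  h.smooth_s.contDiffAt (h.isOpen.mem_nhds hy)

theorem differentiableAt_r (hy : y ∈ D) : DifferentiableAt ℝ r y :=
  (h.contDiffAt_r hy).differentiableAt (by simp)

theorem differentiableAt_s (hy : y ∈ D) : DifferentiableAt ℝ s y :=
  (h.contDiffAt_s hy).differentiableAt (by simp)

theorem contDiffOn_dynamicVolume : ContDiffOn ℝ ∞ (dynamicVolume r) D := by
  rw [dynamicVolume_eq]
  exact (contDiff_fst.add contDiff_snd).contDiffOn.div (h.smooth_r.pow 2)
    fun y hy => pow_ne_zero 2 (h.r_pos y hy).ne'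

theorem contDiffAt_dynamicVolume (hy : y ∈ D) : ContDiffAt ℝ ∞ (dynamicVolume r) y :=
  h.contDiffOn_dynamicVolume.contDiffAt (h.isOpen.mem_nhds hy)

theorem dynamicVolume_pos (hy : y ∈ D) : 0 < dynamicVolume r y := by
  rw [dynamicVolume_eq]
  exact div_pos (h.enthalpy_pos y hy) (pow_pos (h.r_pos y hy) 2)

theorem exists_expression (hy : y ∈ D) (hs : dRho s y ≠ 0) :
    ∃ tau, IsEntropyPressureExpression s (dynamicVolume r) tau y :=
  exists_isEntropyPressureExpression (h.contDiffAt_s hy) (h.contDiffAt_dynamicVolume hy) hs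

/-- The derivatives do not depend on the local expression of `τ` chosen, and such an expression
exists as soon as `s'_ρ ≠ 0`. This removes the existential from `H₁`. -/
theorem satisfiesH1_iff :
    SatisfiesH1 D r s ↔ ∀ y ∈ D, dRho s y ≠ 0 ∧ isentropicDeriv s (dynamicVolume r) y < 0 ∧
      0 < isentropicDeriv s (isentropicDeriv s (dynamicVolume r)) y := by
  refine forall₂_congr fun y hy => ⟨?_, ?_⟩
  · rintro ⟨tau, htau, h1, h2⟩
    rw [htau.deriv_pressure (h.differentiableAt_s hy)] at h1
    rw [htau.iteratedDeriv_two_pressure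
      ((h.contDiffAt_s hy).of_le (by exact_mod_cast le_top))] at h2
    exact ⟨htau.dRho_ne_zero (h.differentiableAt_s hy), h1, h2⟩
  · rintro ⟨hs, h1, h2⟩
    obtain ⟨tau, htau⟩ := h.exists_expression hy hs
    refine ⟨tau, htau, ?_, ?_⟩
    · rwa [htau.deriv_pressure (h.differentiableAt_s hy)]
    · rwa [htau.iteratedDeriv_two_pressure
        ((h.contDiffAt_s hy).of_le (by exact_mod_cast le_top))]

theorem satisfiesH2_of_forall
    (h2 : ∀ y ∈ D, dRho s y ≠ 0 ∧ 0 < dRho (dynamicVolume r) y / dRho s y) :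
    SatisfiesH2 D r s := fun y hy => by
  obtain ⟨tau, htau⟩ := h.exists_expression hy (h2 y hy).1
  refine ⟨tau, htau, ?_⟩
  rw [htau.deriv_entropy (h.differentiableAt_s hy)]
  exact (h2 y hy).2

theorem satisfiesH2bar_of_forall
    (h2 : ∀ y ∈ D, dRho s y ≠ 0 ∧ dRho (dynamicVolume r) y / dRho s y < 0) :
    SatisfiesH2bar D r s := fun y hy => by
  obtain ⟨tau, htau⟩ := h.exists_expression hy (h2 y hy).1
  refine ⟨tau, htau, ?_⟩
  rw [htau.deriv_entropy (h.differentiableAt_s hy)]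
  exact (h2 y hy).2

theorem contDiffOn_of_isSquareSoundSpeed (hchi : IsSquareSoundSpeed D r s chi) :
    ContDiffOn ℝ ∞ chi D :=
  ((h.smooth_s.dRho h.isOpen).div (h.smooth_s.dP h.isOpen) fun y hy => (hchi y hy).1).neg.congr
    fun y hy => (hchi y hy).2.2.1

/-- `(τ'_p)_s = (1 - 1/χ) / r²` -/
theorem isentropicDeriv_dynamicVolume (hchi : IsSquareSoundSpeed D r s chi) (hy : y ∈ D)
    (h0 : dRho s y ≠ 0) :
    isentropicDeriv s (dynamicVolume r) y = (1 - (chi y)⁻¹) / r y ^ 2 := by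
  obtain ⟨h1, h2, h3, h4⟩ := hchi y hy
  have hr := (h.r_pos y hy).ne'
  have he := (h.enthalpy_pos y hy).ne'
  have hc : dP s y / dRho s y = -(chi y)⁻¹ := by rw [h3]; field_simp
  have hc0 : chi y ≠ 0 := by rw [h3]; exact neg_ne_zero.2 (div_ne_zero h0 h1)
  -- The second expression of `χ`, solved for `r'_ρ`; after substitution the terms in `r'_p` cancel.
  have hrr : dRho r y = r y / (y.1 + y.2) - chi y * dP r y := by rw [h4]; field_simp; ring
  rw [isentropicDeriv, hc, dP_dynamicVolume (h.differentiableAt_r hy) hr,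
    dRho_dynamicVolume (h.differentiableAt_r hy) hr, hrr]
  field_simp
  ring

theorem isentropicDeriv_isentropicDeriv_dynamicVolume (hchi : IsSquareSoundSpeed D r s chi)
    (h0 : ∀ y ∈ D, dRho s y ≠ 0) (hy : y ∈ D) :
    isentropicDeriv s (isentropicDeriv s (dynamicVolume r)) y =
      ((y.1 + y.2) * (chi y * dP chi y + dRho chi y) + 2 * chi y * (1 - chi y)) /
        (chi y ^ 3 * r y ^ 2 * (y.1 + y.2)) := by
  -- The formula for the first derivative is differentiated again, so it must hold near `y` and not
  -- only at `y`.
  have hev : isentropicDeriv s (dynamicVolume r) =ᶠ[𝓝 y] fun y => (1 - (chi y)⁻¹) / r y ^ 2 := by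
    filter_upwards [h.isOpen.mem_nhds hy] with y' hy'
    exact h.isentropicDeriv_dynamicVolume hchi hy' (h0 y' hy')
  obtain ⟨h1, h2, h3, h4⟩ := hchi y hy
  have hr := (h.r_pos y hy).ne'
  have he := (h.enthalpy_pos y hy).ne'
  have hc : dP s y / dRho s y = -(chi y)⁻¹ := by
    have := h0 y hy
    rw [h3]; field_simp
  have hc0 : chi y ≠ 0 := by rw [h3]; exact neg_ne_zero.2 (div_ne_zero (h0 y hy) h1)
  have hrr : dRho r y = r y / (y.1 + y.2) - chi y * dP r y := by rw [h4]; field_simp; ring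
  have hcd : DifferentiableAt ℝ chi y := ((h.contDiffOn_of_isSquareSoundSpeed hchi).contDiffAt
    (h.isOpen.mem_nhds hy)).differentiableAt (by simp)
  have hcd' : DifferentiableAt ℝ (fun y => 1 - (chi y)⁻¹) y := (hcd.fun_inv hc0).const_sub 1
  have hrd := h.differentiableAt_r hy
  rw [hev.isentropicDeriv_eq, isentropicDeriv, hc, dP_div_sq hcd' hrd hr, dRho_div_sq hcd' hrd hr,
    dP_one_sub_inv hcd hc0, dRho_one_sub_inv hcd hc0, hrr]
  field_simp
  ring

/-- The first inequality says `1 < 1/χ`, that is `0 < χ < 1`; the denominator of the second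
derivative is then positive and only its numerator matters. -/
theorem satisfiesH1_iff_satisfiesH1Chi (hchi : IsSquareSoundSpeed D r s chi)
    (h0 : ∀ y ∈ D, dRho s y ≠ 0) : SatisfiesH1 D r s ↔ SatisfiesH1Chi D chi := by
  rw [h.satisfiesH1_iff]
  refine forall₂_congr fun y hy => ?_
  have hr := pow_pos (h.r_pos y hy) 2
  have he := h.enthalpy_pos y hy
  have hc0 : chi y ≠ 0 := by
    rw [(hchi y hy).2.2.1]
    exact neg_ne_zero.2 (div_ne_zero (h0 y hy) (hchi y hy).1)
  rw [h.isentropicDeriv_dynamicVolume hchi hy (h0 y hy),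
    h.isentropicDeriv_isentropicDeriv_dynamicVolume hchi h0 hy, div_lt_iff₀ hr, zero_mul,
    sub_neg, and_iff_right (h0 y hy), one_lt_inv_iff₀, and_assoc]
  refine and_congr_right fun hc => and_congr_right fun _ => ?_
  exact div_pos_iff_of_pos_right (by positivity)

theorem isLTEFluid_of_isSquareSoundSpeed (hchi : IsSquareSoundSpeed D r s chi) :
    IsLTEFluid D r s where
  toIsStateData := h
  energy_balance := by
    -- `Θ` is read off the pressure component of the energy balance; the equality of the two
    -- expressions of `χ` is then the energy-density component.
    refine ⟨fun y => -((y.1 + y.2) * dP r y / r y ^ 2) / dP s y, fun y hy => ?_⟩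
    obtain ⟨h1, h2, h3, h4⟩ := hchi y hy
    have hr := (h.r_pos y hy).ne'
    have he := (h.enthalpy_pos y hy).ne'
    have hsr : dRho s y = -(chi y * dP s y) := by rw [h3]; field_simp
    have hrr : dRho r y = r y / (y.1 + y.2) - chi y * dP r y := by rw [h4]; field_simp; ring
    refine ⟨div_ne_zero (neg_ne_zero.2 (div_ne_zero (mul_ne_zero he h2) (pow_ne_zero 2 hr))) h1,
      (energy_balance_iff (h.differentiableAt_r hy) hr _).2 ⟨?_, ?_⟩⟩
    · rw [hsr, hrr]
      field_simp
      ring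
    · field_simp

end IsStateData

namespace IsLTEFluid

variable {D : Set (ℝ × ℝ)} {r s : ℝ × ℝ → ℝ} {y : ℝ × ℝ} (h : IsLTEFluid D r s)
include h

theorem dP_entropy_eq_zero_iff (hy : y ∈ D) : dP s y = 0 ↔ dP r y = 0 := by
  obtain ⟨Theta, hT⟩ := h.energy_balance
  have hr := (h.r_pos y hy).ne'
  have he := (h.enthalpy_pos y hy).ne'
  have h2 := ((energy_balance_iff (h.differentiableAt_r hy) hr _).1 (hT y hy).2).2
  rw [← mul_eq_zero_iff_left (hT y hy).1, h2]
  simp [hr, he]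

/-- If `s'_p = 0` then `r'_p = 0`, so the isentropic derivative of `τ` is `1 / r² > 0`, against
`H₁`. -/
theorem dP_entropy_ne_zero (h1 : SatisfiesH1 D r s) (hy : y ∈ D) : dP s y ≠ 0 := fun h0 => by
  have hr := h.r_pos y hy
  have hneg := (h.satisfiesH1_iff.1 h1 y hy).2.1
  rw [isentropicDeriv, h0, dP_dynamicVolume (h.differentiableAt_r hy) hr.ne',
    (h.dP_entropy_eq_zero_iff hy).1 h0] at hneg
  simp only [zero_div, mul_zero, sub_zero] at hneg
  exact absurd hneg (not_lt.2 (by positivity))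

theorem isSquareSoundSpeed (h1 : SatisfiesH1 D r s) :
    IsSquareSoundSpeed D r s fun y => -(dRho s y / dP s y) := fun y hy => by
  obtain ⟨Theta, hT⟩ := h.energy_balance
  have hr := (h.r_pos y hy).ne'
  have he := (h.enthalpy_pos y hy).ne'
  have hs := h.dP_entropy_ne_zero h1 hy
  have hrp : dP r y ≠ 0 := (h.dP_entropy_eq_zero_iff hy).not.1 hs
  obtain ⟨h2, h3⟩ := (energy_balance_iff (h.differentiableAt_r hy) hr _).1 (hT y hy).2
  refine ⟨hs, hrp, rfl, ?_⟩
  have h4 : dRho s y / dP s y = (1 / r y - (y.1 + y.2) * dRho r y / r y ^ 2) /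
      -((y.1 + y.2) * dP r y / r y ^ 2) := by
    rw [← h2, ← h3, mul_div_mul_left _ _ (hT y hy).1]
  simp only [h4]
  field_simp

theorem satisfiesH1Chi (h1 : SatisfiesH1 D r s) :
    SatisfiesH1Chi D fun y => -(dRho s y / dP s y) :=
  (h.satisfiesH1_iff_satisfiesH1Chi (h.isSquareSoundSpeed h1)
    fun y hy => (h.satisfiesH1_iff.1 h1 y hy).1).1 h1

end IsLTEFluid

/-- The condition `s'_ρ ≠ 0` comes for free: `s'_ρ = 0` would give `χ = 0`. -/
theorem IsStateData.satisfiesH1_of_satisfiesH1Chi {D : Set (ℝ × ℝ)} {r s chi : ℝ × ℝ → ℝ}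
    (h : IsStateData D r s) (hchi : IsSquareSoundSpeed D r s chi) (h1 : SatisfiesH1Chi D chi) :
    SatisfiesH1 D r s := by
  refine (h.satisfiesH1_iff_satisfiesH1Chi hchi fun y hy h0 => ?_).2 h1
  have := (h1 y hy).1
  simp [(hchi y hy).2.2.1, h0] at this

end Thermodynamics

/-! ### The energy equation along the flow. -/

section Flow

variable {M : Type*} [TopologicalSpace M]
  [ChartedSpace (EuclideanSpace ℝ (Fin 4)) M] [IsManifold (𝓡 4) ∞ M] {g : LorentzMetric M}

namespace PerfectEnergyTensor

variable (T : PerfectEnergyTensor g)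

theorem dot_comp_state {z : ℝ × ℝ → ℝ} {x : M} (hz : DifferentiableAt ℝ z (T.state x)) :
    T.dot (fun x' => z (T.state x')) x
      = T.dot T.rho x * dRho z (T.state x) + T.dot T.p x * dP z (T.state x) := by
  have hr : MDifferentiableAt (𝓡 4) 𝓘(ℝ, ℝ) T.rho x := (T.smooth_rho x).mdifferentiableAt (by simp)
  have hp : MDifferentiableAt (𝓡 4) 𝓘(ℝ, ℝ) T.p x := (T.smooth_p x).mdifferentiableAt (by simp)
  have h : HasMFDerivAt (𝓡 4) 𝓘(ℝ, ℝ) (fun x' => z (T.state x')) x _ :=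
    HasMFDerivAt.comp x hz.hasFDerivAt.hasMFDerivAt
      (HasMFDerivAt.prodMk hr.hasMFDerivAt hp.hasMFDerivAt)
  rw [dot, scalarDeriv, mvfderiv, h.mfderiv]
  exact fderiv_prod_apply_eq z (T.state x) _

variable {T} {nabla : CovariantDerivative (𝓡 4) (EuclideanSpace ℝ (Fin 4))
      (TangentSpace (𝓡 4) : M → Type _)}

/-- Differentiate `g(u, u) = -1`. -/
theorem metric_nabla_u_u (hnabla : IsLeviCivita g nabla) (x : M) (v : TangentSpace (𝓡 4) x) :
    g.val x (T.u x) (nabla T.u x v) = 0 := by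
  have hu : MDifferentiableAt (𝓡 4) (𝓡 4).tangent (vectorFieldMap T.u) x :=
    (T.smooth_u x).mdifferentiableAt (by simp)
  have h := hnabla.metric T.u T.u x v hu hu
  have h0 : (fun y => g.val y (T.u y) (T.u y)) = fun _ => (-1 : ℝ) := funext T.unit_u
  rw [h0, scalarDeriv, mvfderiv_const, g.symm x (nabla T.u x v)] at h
  have h1 : (0 : ℝ) = g.val x (T.u x) (nabla T.u x v) + g.val x (T.u x) (nabla T.u x v) := h
  linarith

/-- The energy equation `ρ̇ + (ρ + p) θ = 0`. -/
theorem dot_rho_add (hnabla : IsLeviCivita g nabla) (hcons : T.IsConservative nabla) (x : M) :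
    T.dot T.rho x + (T.rho x + T.p x) * divVector nabla T.u x = 0 := by
  have hu : MDifferentiableAt (𝓡 4) (𝓡 4).tangent (vectorFieldMap T.u) x :=
    (T.smooth_u x).mdifferentiableAt (by simp)
  have hr : MDifferentiableAt (𝓡 4) 𝓘(ℝ, ℝ) (-T.rho) x :=
    ((T.smooth_rho x).mdifferentiableAt (by simp)).neg
  have h := hcons T.u T.smooth_u x
  -- `u` is an eigenvector of `T` with eigenvalue `-ρ`, while `T` acts as `p` on the image of `∇u`,
  -- which is orthogonal to `u`. The divergence is thus the trace of `∇(-ρ u) - p ∇u`.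
  have h1 : (fun y => T.mixed y (T.u y)) = (-T.rho) • T.u := by
    funext y
    simp only [mixed, add_apply, smul_apply,
      ContinuousLinearMap.smulRight_apply, T.unit_u, ContinuousLinearMap.id_apply, Pi.smul_apply',
      Pi.neg_apply]
    module
  have h2 : (T.mixed x).comp (nabla T.u x) = T.p x • nabla T.u x := by
    ext v : 1
    simp [mixed, metric_nabla_u_u hnabla]
  have h3 := nabla.isCovariantDerivativeOn.leibniz hu hr
  have h4 : (((-T.rho) x • nabla T.u x + (mvfderiv (𝓡 4) (-T.rho) x).smulRight (T.u x)
        - T.p x • nabla T.u x : TangentSpace (𝓡 4) x →L[ℝ] TangentSpace (𝓡 4) x)).toLinearMap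
      = -((T.rho x + T.p x) • (nabla T.u x).toLinearMap
        + (mvfderiv (𝓡 4) T.rho x).toLinearMap.smulRight (T.u x)) := by
    rw [mvfderiv_neg]
    ext v : 1
    simp
    module
  have : Module.Finite ℝ (TangentSpace (𝓡 4) x) :=
    inferInstanceAs (Module.Finite ℝ (EuclideanSpace ℝ (Fin 4)))
  have : Module.Free ℝ (TangentSpace (𝓡 4) x) :=
    inferInstanceAs (Module.Free ℝ (EuclideanSpace ℝ (Fin 4)))
  rw [divTensor, h1, h2, h3, h4, map_neg, map_add, map_smul, LinearMap.trace_smulRight,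
    neg_eq_zero, add_comm] at h
  exact h

theorem divVector_eq_zero (hnabla : IsLeviCivita g nabla) (hcons : T.IsConservative nabla)
    (hiso : T.IsIsoenergetic) (x : M) : divVector nabla T.u x = 0 := by
  have h := dot_rho_add hnabla hcons x
  rw [hiso x, zero_add] at h
  exact (mul_eq_zero.1 h).resolve_left (T.enthalpy_pos x).ne'

end PerfectEnergyTensor
end Flow

/-! ### Evolution equations and isobaroenergetic flows. -/

section Evolution

variable {M : Type*} [TopologicalSpace M]
  [ChartedSpace (EuclideanSpace ℝ (Fin 4)) M] [IsManifold (𝓡 4) ∞ M] {g : LorentzMetric M}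
  {nabla : CovariantDerivative (𝓡 4) (EuclideanSpace ℝ (Fin 4)) (TangentSpace (𝓡 4) : M → Type _)}
  {T : PerfectEnergyTensor g} {D : Set (ℝ × ℝ)} {r s chi : ℝ × ℝ → ℝ}

theorem PerfectEnergyTensor.evolutionEquations_of_isIsobaroenergetic
    (hθ : ∀ x, divVector nabla T.u x = 0) (hT : T.IsIsobaroenergetic) (h : IsStateData D r s) :
    T.EvolutionEquations nabla D r s := fun x hx => by
  rw [T.dot_comp_state (h.differentiableAt_r hx), T.dot_comp_state (h.differentiableAt_s hx), hθ x,
    (hT x).1, (hT x).2]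
  simp

theorem PerfectEnergyTensor.Represents.isIsobaroenergetic (hiso : T.IsIsoenergetic)
    (h : T.Represents nabla D r s) (h1 : SatisfiesH1 D r s) : T.IsIsobaroenergetic := fun x => by
  have hx := h.state_mem x
  have hs := (h.evolution x hx).2
  rw [T.dot_comp_state (h.fluid.differentiableAt_s hx), hiso x, zero_mul, zero_add] at hs
  exact ⟨hiso x, (mul_eq_zero.1 hs).resolve_right (h.fluid.dP_entropy_ne_zero h1 hx)⟩

theorem PerfectEnergyTensor.represents_of_isSquareSoundSpeed
    (hθ : ∀ x, divVector nabla T.u x = 0) (hT : T.IsIsobaroenergetic) (hm : ∀ x, T.state x ∈ D)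
    (h : IsStateData D r s) (hchi : IsSquareSoundSpeed D r s chi) : T.Represents nabla D r s where
  fluid := h.isLTEFluid_of_isSquareSoundSpeed hchi
  state_mem := hm
  evolution := evolutionEquations_of_isIsobaroenergetic hθ hT h

end Evolution

/-! ### An explicit fluid with `χ = 1/3`. -/

section RadiationFluid

/-- The half-plane `ρ + p > 0`. -/
def enthalpyHalfPlane : Set (ℝ × ℝ) := {y | 0 < y.1 + y.2}

/-- The matter density `(ρ + p)^(3/4)`, for which `χ = 1/3`. -/
noncomputable def radiationDensity (y : ℝ × ℝ) : ℝ := (y.1 + y.2) ^ (3 / 4 : ℝ)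

/-- An entropy constant along the characteristics of `χ = 1/3`. -/
noncomputable def radiationEntropy (c : ℝ) (y : ℝ × ℝ) : ℝ := c * (y.2 - y.1 / 3)

theorem isStateData_radiation (c : ℝ) :
    IsStateData enthalpyHalfPlane radiationDensity (radiationEntropy c) where
  isOpen := isOpen_lt continuous_const (continuous_fst.add continuous_snd)
  enthalpy_pos _ hy := hy
  smooth_r := (contDiff_fst.add contDiff_snd).contDiffOn.rpow_const_of_ne fun _ hy => ne_of_gt hy
  smooth_s := (contDiff_const.mul (contDiff_snd.sub (contDiff_fst.div_const 3))).contDiffOn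
  r_pos _ hy := Real.rpow_pos_of_pos hy _

section

variable {y : ℝ × ℝ} (hy : y ∈ enthalpyHalfPlane) (c : ℝ)
include hy

theorem dRho_radiationDensity :
    dRho radiationDensity y = 3 / 4 * (radiationDensity y / (y.1 + y.2)) := by
  refine dRho_eq_of_hasDerivAt ((isStateData_radiation 0).differentiableAt_r hy) ?_
  refine (((hasDerivAt_id y.1).add_const y.2).rpow_const (Or.inl (ne_of_gt hy))).congr_deriv ?_
  rw [radiationDensity, id_eq, Real.rpow_sub_one (ne_of_gt hy), one_mul]

theorem dP_radiationDensity :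
    dP radiationDensity y = 3 / 4 * (radiationDensity y / (y.1 + y.2)) := by
  refine dP_eq_of_hasDerivAt ((isStateData_radiation 0).differentiableAt_r hy) ?_
  refine (((hasDerivAt_id y.2).const_add y.1).rpow_const (Or.inl (ne_of_gt hy))).congr_deriv ?_
  rw [radiationDensity, id_eq, Real.rpow_sub_one (ne_of_gt hy), one_mul]

theorem dRho_radiationEntropy : dRho (radiationEntropy c) y = -(c / 3) := by
  refine dRho_eq_of_hasDerivAt ((isStateData_radiation c).differentiableAt_s hy) ?_
  refine ((((hasDerivAt_id y.1).div_const 3).const_sub y.2).const_mul c).congr_deriv ?_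
  ring

theorem dP_radiationEntropy : dP (radiationEntropy c) y = c := by
  refine dP_eq_of_hasDerivAt ((isStateData_radiation c).differentiableAt_s hy) ?_
  refine (((hasDerivAt_id y.2).sub_const (y.1 / 3)).const_mul c).congr_deriv ?_
  ring

theorem dRho_dynamicVolume_div_radiationEntropy {c : ℝ} (hc : c ≠ 0) :
    dRho (dynamicVolume radiationDensity) y / dRho (radiationEntropy c) y
      = 3 / (2 * radiationDensity y ^ 2) / c := by
  have hr := ((isStateData_radiation c).r_pos y hy).ne'
  have he := ((isStateData_radiation c).enthalpy_pos y hy).ne'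
  rw [dRho_dynamicVolume ((isStateData_radiation c).differentiableAt_r hy) hr,
    dRho_radiationDensity hy, dRho_radiationEntropy hy]
  field_simp
  ring

end

variable {c : ℝ}

/-- For `r = (ρ + p)^k` the second expression is `(1 - k) / k`, which equals `1/3` exactly for `k =
3/4`. -/
theorem isSquareSoundSpeed_radiation (hc : c ≠ 0) :
    IsSquareSoundSpeed enthalpyHalfPlane radiationDensity (radiationEntropy c) fun _ => 1 / 3 :=
    fun y hy => by
  have hr := ((isStateData_radiation c).r_pos y hy).ne'
  have he := ((isStateData_radiation c).enthalpy_pos y hy).ne'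
  rw [dP_radiationEntropy hy, dRho_radiationEntropy hy, dP_radiationDensity hy,
    dRho_radiationDensity hy]
  refine ⟨hc, by positivity, ?_, ?_⟩
  · field_simp
  · field_simp
    norm_num

theorem satisfiesH1Chi_const {D : Set (ℝ × ℝ)} {a : ℝ} (h0 : 0 < a) (h1 : a < 1) :
    SatisfiesH1Chi D fun _ => a := fun y _ => by
  have : 0 < 1 - a := sub_pos.2 h1
  refine ⟨h0, h1, ?_⟩
  simp only [dP, dRho, fderiv_fun_const, Pi.zero_apply, zero_apply]
  norm_num
  positivity

theorem satisfiesH1_radiation (hc : c ≠ 0) :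
    SatisfiesH1 enthalpyHalfPlane radiationDensity (radiationEntropy c) :=
  (isStateData_radiation c).satisfiesH1_of_satisfiesH1Chi (isSquareSoundSpeed_radiation hc)
    (satisfiesH1Chi_const (by norm_num) (by norm_num))

theorem satisfiesH2_radiation :
    SatisfiesH2 enthalpyHalfPlane radiationDensity (radiationEntropy 1) := by
  refine (isStateData_radiation 1).satisfiesH2_of_forall fun y hy => ⟨?_, ?_⟩
  · rw [dRho_radiationEntropy hy]
    norm_num
  · have hr := (isStateData_radiation 1).r_pos y hy
    rw [dRho_dynamicVolume_div_radiationEntropy hy one_ne_zero]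
    positivity

theorem satisfiesH2bar_radiation :
    SatisfiesH2bar enthalpyHalfPlane radiationDensity (radiationEntropy (-1)) := by
  refine (isStateData_radiation (-1)).satisfiesH2bar_of_forall fun y hy => ⟨?_, ?_⟩
  · rw [dRho_radiationEntropy hy]
    norm_num
  · have hr := (isStateData_radiation (-1)).r_pos y hy
    rw [dRho_dynamicVolume_div_radiationEntropy hy (by norm_num), div_neg, div_one, neg_lt_zero]
    positivity

end RadiationFluid

/-! ### Entropy-dependent rescaling of the matter density. -/

section Rescaling

variable {D : Set (ℝ × ℝ)} {r s chi : ℝ × ℝ → ℝ}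

/-- The part of `D` on which the rescaling of `r` by `exp (-λ s)` keeps `r'_p ≠ 0` and makes
`(τ'_s)_p` positive. -/
def rescalingRegion (D : Set (ℝ × ℝ)) (r s : ℝ × ℝ → ℝ) (lam : ℝ) : Set (ℝ × ℝ) :=
  {y ∈ D | 0 < dRho (dynamicVolume r) y / dRho s y + 2 * lam * dynamicVolume r y ∧
    0 < lam * r y - dP r y / dP s y}

theorem rescalingRegion_subset (lam : ℝ) : rescalingRegion D r s lam ⊆ D := fun _ h => h.1

theorem continuousOn_dRho_dynamicVolume_div (h : IsStateData D r s)
    (h0 : ∀ y ∈ D, dRho s y ≠ 0) :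
    ContinuousOn (fun y => dRho (dynamicVolume r) y / dRho s y) D :=
  (h.contDiffOn_dynamicVolume.dRho h.isOpen).continuousOn.div
    (h.smooth_s.dRho h.isOpen).continuousOn h0

theorem continuousOn_dP_div (h : IsStateData D r s) (h0 : ∀ y ∈ D, dP s y ≠ 0) :
    ContinuousOn (fun y => dP r y / dP s y) D :=
  (h.smooth_r.dP h.isOpen).continuousOn.div (h.smooth_s.dP h.isOpen).continuousOn h0

theorem isOpen_rescalingRegion (h : IsStateData D r s) (h0 : ∀ y ∈ D, dRho s y ≠ 0)
    (h1 : ∀ y ∈ D, dP s y ≠ 0) (lam : ℝ) : IsOpen (rescalingRegion D r s lam) := by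
  have hc1 : ContinuousOn
      (fun y => dRho (dynamicVolume r) y / dRho s y + 2 * lam * dynamicVolume r y) D :=
    (continuousOn_dRho_dynamicVolume_div h h0).add
      (continuousOn_const.mul h.contDiffOn_dynamicVolume.continuousOn)
  have hc2 : ContinuousOn (fun y => lam * r y - dP r y / dP s y) D :=
    (continuousOn_const.mul h.smooth_r.continuousOn).sub (continuousOn_dP_div h h1)
  have ho := (hc1.prodMk hc2).isOpen_inter_preimage h.isOpen
    ((isOpen_Ioi (a := (0 : ℝ))).prod (isOpen_Ioi (a := (0 : ℝ))))
  exact ho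

theorem exists_subset_rescalingRegion (h : IsStateData D r s) (h0 : ∀ y ∈ D, dRho s y ≠ 0)
    (h1 : ∀ y ∈ D, dP s y ≠ 0) {K : Set (ℝ × ℝ)} (hK : IsCompact K) (hKD : K ⊆ D) :
    ∃ lam, K ⊆ rescalingRegion D r s lam := by
  have hc1 : ContinuousOn
      (fun y => -(dRho (dynamicVolume r) y / dRho s y) / (2 * dynamicVolume r y)) D :=
    (continuousOn_dRho_dynamicVolume_div h h0).neg.div
      (continuousOn_const.mul h.contDiffOn_dynamicVolume.continuousOn)
      fun y hy => mul_ne_zero two_ne_zero (h.dynamicVolume_pos hy).ne'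
  have hc2 : ContinuousOn (fun y => dP r y / dP s y / r y) D :=
    (continuousOn_dP_div h h1).div h.smooth_r.continuousOn fun y hy => (h.r_pos y hy).ne'
  obtain ⟨a, ha⟩ := hK.bddAbove_image (hc1.mono hKD)
  obtain ⟨b, hb⟩ := hK.bddAbove_image (hc2.mono hKD)
  -- `a` and `b` bound on `K` the thresholds that `λ` must exceed for the two inequalities; adding
  -- `1` makes them strict.
  refine ⟨max a b + 1, fun y hy => ⟨hKD hy, ?_, ?_⟩⟩
  · have h2 : _ < max a b + 1 := (ha (Set.mem_image_of_mem _ hy)).trans_lt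
      ((le_max_left a b).trans_lt (lt_add_one _))
    rw [div_lt_iff₀ (mul_pos two_pos (h.dynamicVolume_pos (hKD hy)))] at h2
    linarith
  · have h2 : _ < max a b + 1 := (hb (Set.mem_image_of_mem _ hy)).trans_lt
      ((le_max_right a b).trans_lt (lt_add_one _))
    rw [div_lt_iff₀ (h.r_pos y (hKD hy))] at h2
    linarith

theorem isStateData_rescaled (h : IsStateData D r s) {V : Set (ℝ × ℝ)} (hV : IsOpen V)
    (hVD : V ⊆ D) (lam c : ℝ) :
    IsStateData V (fun y => r y * Real.exp (-lam * s y)) fun y => c * s y where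
  isOpen := hV
  enthalpy_pos y hy := h.enthalpy_pos y (hVD hy)
  smooth_r := (h.smooth_r.mul (contDiffOn_const.mul h.smooth_s).exp).mono hVD
  smooth_s := (contDiffOn_const.mul h.smooth_s).mono hVD
  r_pos y hy := mul_pos (h.r_pos y (hVD hy)) (Real.exp_pos _)

section

variable (h : IsStateData D r s) {y : ℝ × ℝ} (hy : y ∈ D) (lam c : ℝ)
include h hy

theorem dRho_rescaled_density :
    dRho (fun y => r y * Real.exp (-lam * s y)) y
      = (dRho r y - lam * r y * dRho s y) * Real.exp (-lam * s y) := by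
  refine dRho_eq_of_hasDerivAt
    ((isStateData_rescaled h h.isOpen subset_rfl lam 0).differentiableAt_r hy) ?_
  refine ((hasDerivAt_dRho (h.differentiableAt_r hy)).mul
    ((hasDerivAt_dRho (h.differentiableAt_s hy)).const_mul (-lam)).exp).congr_deriv ?_
  ring

theorem dP_rescaled_density :
    dP (fun y => r y * Real.exp (-lam * s y)) y
      = (dP r y - lam * r y * dP s y) * Real.exp (-lam * s y) := by
  refine dP_eq_of_hasDerivAt
    ((isStateData_rescaled h h.isOpen subset_rfl lam 0).differentiableAt_r hy) ?_
  refine ((hasDerivAt_dP (h.differentiableAt_r hy)).mul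
    ((hasDerivAt_dP (h.differentiableAt_s hy)).const_mul (-lam)).exp).congr_deriv ?_
  ring

theorem dRho_rescaled_entropy : dRho (fun y => c * s y) y = c * dRho s y :=
  dRho_eq_of_hasDerivAt ((h.differentiableAt_s hy).const_mul c)
    ((hasDerivAt_dRho (h.differentiableAt_s hy)).const_mul c)

theorem dP_rescaled_entropy : dP (fun y => c * s y) y = c * dP s y :=
  dP_eq_of_hasDerivAt ((h.differentiableAt_s hy).const_mul c)
    ((hasDerivAt_dP (h.differentiableAt_s hy)).const_mul c)

theorem dRho_rescaled_dynamicVolume_div {c : ℝ} (hc : c ≠ 0) (h0 : dRho s y ≠ 0) :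
    dRho (dynamicVolume fun y => r y * Real.exp (-lam * s y)) y / dRho (fun y => c * s y) y
      = (dRho (dynamicVolume r) y / dRho s y + 2 * lam * dynamicVolume r y) /
        Real.exp (-lam * s y) ^ 2 / c := by
  have h1 := isStateData_rescaled h h.isOpen subset_rfl lam c
  have hr := (h.r_pos y hy).ne'
  have he := (Real.exp_pos (-lam * s y)).ne'
  rw [dRho_dynamicVolume (h1.differentiableAt_r hy) (h1.r_pos y hy).ne',
    dRho_rescaled_density h hy, dRho_rescaled_entropy h hy,
    dRho_dynamicVolume (h.differentiableAt_r hy) hr, dynamicVolume_eq]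
  field_simp
  ring

end

/-- `s'_ρ / s'_p` is insensitive to the factor `c`. In the second expression the new terms `-λ r
s'_ρ` and `-λ r s'_p` have the ratio `-χ`, so they cancel. The region is used only to keep the new
`r'_p` nonzero. -/
theorem isSquareSoundSpeed_rescaled (h : IsStateData D r s)
    (hchi : IsSquareSoundSpeed D r s chi) (lam : ℝ) {c : ℝ} (hc : c ≠ 0) :
    IsSquareSoundSpeed (rescalingRegion D r s lam) (fun y => r y * Real.exp (-lam * s y))
      (fun y => c * s y) chi := fun y hy => by
  obtain ⟨hyD, _, hy2⟩ := hy
  obtain ⟨h1, h2, h3, h4⟩ := hchi y hyD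
  have he := (Real.exp_pos (-lam * s y)).ne'
  have he' := (h.enthalpy_pos y hyD).ne'
  have h5 : dP r y - lam * r y * dP s y ≠ 0 := fun h6 => by
    have h7 : dP r y = lam * r y * dP s y := sub_eq_zero.1 h6
    rw [h7, mul_div_cancel_right₀ _ h1, sub_self] at hy2
    exact lt_irrefl _ hy2
  have hsr : dRho s y = -(chi y * dP s y) := by rw [h3]; field_simp
  have hrr : dRho r y = r y / (y.1 + y.2) - chi y * dP r y := by rw [h4]; field_simp; ring
  rw [dP_rescaled_entropy h hyD, dRho_rescaled_entropy h hyD, dP_rescaled_density h hyD,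
    dRho_rescaled_density h hyD, mul_div_mul_left _ _ hc]
  refine ⟨mul_ne_zero hc h1, mul_ne_zero h5 he, h3, ?_⟩
  rw [hsr, hrr]
  field_simp
  ring

theorem SatisfiesH1Chi.mono {V : Set (ℝ × ℝ)} (h : SatisfiesH1Chi D chi) (hV : V ⊆ D) :
    SatisfiesH1Chi V chi := fun y hy => h y (hV hy)

/-- Around a compact set, an entropy-dependent change of scale of the matter density and a change
of scale `c ≠ 0` of the entropy keep `H₁` and give `(τ'_s)_p` the sign of `c`. -/
theorem exists_rescaled_fluid (h : IsLTEFluid D r s) (h1 : SatisfiesH1 D r s) {K : Set (ℝ × ℝ)}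
    (hK : IsCompact K) (hKD : K ⊆ D) :
    ∃ (V : Set (ℝ × ℝ)) (lam : ℝ), K ⊆ V ∧ V ⊆ D ∧ ∀ c : ℝ, c ≠ 0 →
      IsLTEFluid V (fun y => r y * Real.exp (-lam * s y)) (fun y => c * s y) ∧
      SatisfiesH1 V (fun y => r y * Real.exp (-lam * s y)) (fun y => c * s y) ∧
      (0 < c → SatisfiesH2 V (fun y => r y * Real.exp (-lam * s y)) (fun y => c * s y)) ∧
      (c < 0 → SatisfiesH2bar V (fun y => r y * Real.exp (-lam * s y)) (fun y => c * s y)) := by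
  have hd := h.toIsStateData
  have h0 : ∀ y ∈ D, dRho s y ≠ 0 := fun y hy => (hd.satisfiesH1_iff.1 h1 y hy).1
  have hp : ∀ y ∈ D, dP s y ≠ 0 := fun y hy => h.dP_entropy_ne_zero h1 hy
  obtain ⟨lam, hlam⟩ := exists_subset_rescalingRegion hd h0 hp hK hKD
  -- `V` and `λ` are fixed before `c`, so the same pair serves both signs.
  refine ⟨rescalingRegion D r s lam, lam, hlam, rescalingRegion_subset lam, fun c hc => ?_⟩
  have hd' := isStateData_rescaled hd (isOpen_rescalingRegion hd h0 hp lam)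
    (rescalingRegion_subset lam) lam c
  have hchi := isSquareSoundSpeed_rescaled hd (h.isSquareSoundSpeed h1) lam hc
  have hne : ∀ y ∈ rescalingRegion D r s lam, dRho (fun y => c * s y) y ≠ 0 := fun y hy => by
    rw [dRho_rescaled_entropy hd hy.1]
    exact mul_ne_zero hc (h0 y hy.1)
  refine ⟨hd'.isLTEFluid_of_isSquareSoundSpeed hchi, hd'.satisfiesH1_of_satisfiesH1Chi hchi
    ((h.satisfiesH1Chi h1).mono (rescalingRegion_subset lam)),
    fun hc' => hd'.satisfiesH2_of_forall fun y hy => ⟨hne y hy, ?_⟩,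
    fun hc' => hd'.satisfiesH2bar_of_forall fun y hy => ⟨hne y hy, ?_⟩⟩
  · rw [dRho_rescaled_dynamicVolume_div hd hy.1 lam hc (h0 y hy.1)]
    exact div_pos (div_pos hy.2.1 (pow_pos (Real.exp_pos _) 2)) hc'
  · rw [dRho_rescaled_dynamicVolume_div hd hy.1 lam hc (h0 y hy.1)]
    exact div_neg_of_pos_of_neg (div_pos hy.2.1 (pow_pos (Real.exp_pos _) 2)) hc'

end Rescaling

/-! ### The main theorem. -/

theorem theorem6 {M : Type*} [TopologicalSpace M]
    [ChartedSpace (EuclideanSpace ℝ (Fin 4)) M] [IsManifold (𝓡 4) ∞ M]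
    (g : LorentzMetric M)
    (nabla : CovariantDerivative (𝓡 4) (EuclideanSpace ℝ (Fin 4))
      (TangentSpace (𝓡 4) : M → Type _))
    (hnabla : IsLeviCivita g nabla)
    (T : PerfectEnergyTensor g) (hcons : T.IsConservative nabla)
    (hbar : T.IsNonBarotropic) (hiso : T.IsIsoenergetic) :
    -- characterization, with H₂ and with H̄₂
    ((∃ (D : Set (ℝ × ℝ)) (r s : ℝ × ℝ → ℝ),
        T.Represents nabla D r s ∧ SatisfiesH1 D r s ∧ SatisfiesH2 D r s) ↔
      T.IsIsobaroenergetic) ∧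
    ((∃ (D : Set (ℝ × ℝ)) (r s : ℝ × ℝ → ℝ),
        T.Represents nabla D r s ∧ SatisfiesH1 D r s ∧ SatisfiesH2bar D r s) ↔
      T.IsIsobaroenergetic) ∧
    (T.IsIsobaroenergetic →
      -- the admissible thermodynamic quantities
      (∀ (D : Set (ℝ × ℝ)) (r s : ℝ × ℝ → ℝ), IsStateData D r s → (∀ x, T.state x ∈ D) →
        ((T.Represents nabla D r s ∧ SatisfiesH1 D r s) ↔
          ∃ chi : ℝ × ℝ → ℝ, IsSquareSoundSpeed D r s chi ∧ SatisfiesH1Chi D chi)) ∧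
      -- they generate new admissible quantities that satisfy H₂, and others that satisfy H̄₂
      (∀ (D : Set (ℝ × ℝ)) (r s : ℝ × ℝ → ℝ), T.Represents nabla D r s → SatisfiesH1 D r s →
        ∀ K : Set (ℝ × ℝ), IsCompact K → K ⊆ D →
          (∃ (V : Set (ℝ × ℝ)) (R S : ℝ → ℝ), K ⊆ V ∧ V ⊆ D ∧
            ContDiff ℝ ∞ R ∧ ContDiff ℝ ∞ S ∧ (∀ t, 0 < R t) ∧ (∀ t, deriv S t ≠ 0) ∧
            IsLTEFluid V (fun y => r y * R (s y)) (fun y => S (s y)) ∧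
            T.EvolutionEquations nabla V (fun y => r y * R (s y)) (fun y => S (s y)) ∧
            SatisfiesH1 V (fun y => r y * R (s y)) (fun y => S (s y)) ∧
            SatisfiesH2 V (fun y => r y * R (s y)) (fun y => S (s y))) ∧
          (∃ (V : Set (ℝ × ℝ)) (R S : ℝ → ℝ), K ⊆ V ∧ V ⊆ D ∧
            ContDiff ℝ ∞ R ∧ ContDiff ℝ ∞ S ∧ (∀ t, 0 < R t) ∧ (∀ t, deriv S t ≠ 0) ∧
            IsLTEFluid V (fun y => r y * R (s y)) (fun y => S (s y)) ∧
            T.EvolutionEquations nabla V (fun y => r y * R (s y)) (fun y => S (s y)) ∧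
            SatisfiesH1 V (fun y => r y * R (s y)) (fun y => S (s y)) ∧
            SatisfiesH2bar V (fun y => r y * R (s y)) (fun y => S (s y))))) := by
  have hθ := PerfectEnergyTensor.divVector_eq_zero hnabla hcons hiso
  have hm : ∀ x, T.state x ∈ enthalpyHalfPlane := T.enthalpy_pos
  have hmul : ∀ c t : ℝ, deriv (fun t => c * t) t = c := fun c t => by
    simp
  refine ⟨⟨?_, fun hT => ?_⟩, ⟨?_, fun hT => ?_⟩, fun hT => ⟨fun D r s hd hmem => ⟨?_, ?_⟩, ?_⟩⟩
  · rintro ⟨D, r, s, h, h1, -⟩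
    exact h.isIsobaroenergetic hiso h1
  · exact ⟨enthalpyHalfPlane, radiationDensity, radiationEntropy 1,
      T.represents_of_isSquareSoundSpeed hθ hT hm (isStateData_radiation 1)
        (isSquareSoundSpeed_radiation one_ne_zero),
      satisfiesH1_radiation one_ne_zero, satisfiesH2_radiation⟩
  · rintro ⟨D, r, s, h, h1, -⟩
    exact h.isIsobaroenergetic hiso h1
  · exact ⟨enthalpyHalfPlane, radiationDensity, radiationEntropy (-1),
      T.represents_of_isSquareSoundSpeed hθ hT hm (isStateData_radiation (-1))
        (isSquareSoundSpeed_radiation (by norm_num)),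
      satisfiesH1_radiation (by norm_num), satisfiesH2bar_radiation⟩
  · rintro ⟨h, h1⟩
    exact ⟨_, h.fluid.isSquareSoundSpeed h1, h.fluid.satisfiesH1Chi h1⟩
  · rintro ⟨chi, hchi, h1⟩
    exact ⟨T.represents_of_isSquareSoundSpeed hθ hT hmem hd hchi,
      hd.satisfiesH1_of_satisfiesH1Chi hchi h1⟩
  · intro D r s h h1 K hK hKD
    obtain ⟨V, lam, hKV, hVD, hV⟩ := exists_rescaled_fluid h.fluid h1 hK hKD
    have hR : ContDiff ℝ ∞ fun t : ℝ => Real.exp (-lam * t) := (contDiff_const.mul contDiff_id).exp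
    have hS : ∀ c : ℝ, ContDiff ℝ ∞ fun t : ℝ => c * t := fun c => contDiff_const.mul contDiff_id
    constructor
    · obtain ⟨h2, h3, h4, -⟩ := hV 1 one_ne_zero
      -- Here `R t = e^{-λ t}` and `S t = 1 * t`; the other case takes `S t = -1 * t`.
      exact ⟨V, _, _, hKV, hVD, hR, hS 1, fun t => Real.exp_pos _,
        fun t => (hmul 1 t).trans_ne one_ne_zero, h2,
        PerfectEnergyTensor.evolutionEquations_of_isIsobaroenergetic hθ hT h2.toIsStateData, h3,
        h4 one_pos⟩
    · obtain ⟨h2, h3, -, h4⟩ := hV (-1) (by norm_num)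
      exact ⟨V, _, _, hKV, hVD, hR, hS (-1), fun t => Real.exp_pos _,
        fun t => (hmul (-1) t).trans_ne (by norm_num), h2,
        PerfectEnergyTensor.evolutionEquations_of_isIsobaroenergetic hθ hT h2.toIsStateData, h3,
        h4 (by norm_num)⟩
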